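/- Let $G$ be a finite group and let $X$ be a real separable Banach space with $\dim X \geqslant |G|$ (where $X$ may be finite- or infinite-dimensional). Then $\{-1,1\}\times G$ is displayable on $X$; that is, there is a norm $\|\cdot\|_1$ on $X$ equivalent to the given norm $\|\cdot\|$ (there are $A,B>0$ with $A\|x\|\leqslant\|x\|_1\leqslant B\|x\|$ for all $x\in X$) such that the group $\mathrm{Isom}(X,\|\cdot\|_1)$ of all surjective linear isometries of $(X,\|\cdot\|_1)$ onto itself, under composition, is isomorphic as a group to the direct product $\{-1,1\}\times G$, where $\{-1,1\}$ is the multiplicative group of order two. -/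

import Mathlib

/-- `p` is an equivalent norm on `X`: there are `A, B > 0` with `A ‖x‖ ≤ p x ≤ B ‖x‖` for all `x`.
(The lower bound makes the seminorm `p` a norm.) -/
def IsEquivalentNorm {X : Type*} [NormedAddCommGroup X] [NormedSpace ℝ X]
    (p : Seminorm ℝ X) : Prop :=
  ∃ A B : ℝ, 0 < A ∧ 0 < B ∧ ∀ x : X, A * ‖x‖ ≤ p x ∧ p x ≤ B * ‖x‖

/-- The group `Isom(X, p)` of all surjective linear isometries of `(X, p)`, under composition. -/
def isomGroup {X : Type*} [AddCommGroup X] [Module ℝ X] (p : Seminorm ℝ X) :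
    Subgroup (X ≃ₗ[ℝ] X) where
  carrier := {T | ∀ x : X, p (T x) = p x}
  mul_mem' := fun {S T} hS hT x => (hS (T x)).trans (hT x)
  one_mem' := fun _ => rfl
  inv_mem' := fun {T} hT x => by
    have h := hT (T⁻¹ x)
    rw [← LinearEquiv.mul_apply, mul_inv_cancel, LinearEquiv.coe_one, id] at h
    exact h.symm

/-- The group `H` is displayable on `X`: some equivalent norm on `X` has isometry group
isomorphic to `H` (as an abstract group). -/
def IsDisplayable (H : Type*) [Group H] (X : Type*) [NormedAddCommGroup X] [NormedSpace ℝ X] :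
    Prop :=
  ∃ p : Seminorm ℝ X, IsEquivalentNorm p ∧ Nonempty (H ≃* isomGroup p)

/-! The new norm is `p = q + ∑ |ψ i|`: `q` is an equivalent, `G`-invariant, Gateaux smooth norm, and
the `ψ i` are countably many pairwise non-proportional functionals with summable norms, permuted by
`G`. Away from the origin `p` fails to be smooth exactly on the hyperplanes `ψ i = 0`, and the size
of the kink recovers `|ψ i|`. Hence composing with an isometry permutes the `ψ i` up to sign
(`exists_apply_eq_or_neg_of_isometry`).

Since `dim X ≥ |G|`, the group acts on `X` by permuting independent vectors `v g` and fixing a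
complement. The `ψ i` are multiples of the functionals `e g + 2 e (g h)` and `e g + 2 w`, one
`G`-orbit for each `h` or `w`. The multiples decay so fast from orbit to orbit that an isometry,
whose distortion is bounded, cannot exchange orbits (`enc_le_of_abs_comp_eq`). A map preserving
every orbit up to signs is `±` the action of an element of `G`
(`PreservesTests.exists_eq_translate`). -/

open Filter Topology

/-! ### Equivalent Gateaux smooth norms on separable Banach spaces. -/

/-- The quotient norm on `X` of the Hilbertian sum `X ⊕₂ H` under `(y, a) ↦ y + S a`. -/
noncomputable def smoothSeminorm {X H : Type*} [NormedAddCommGroup X] [NormedSpace ℝ X]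
    [NormedAddCommGroup H] [InnerProductSpace ℝ H] (S : H →L[ℝ] X) : Seminorm ℝ X :=
  Seminorm.ofSMulLE (fun x => ⨅ a : H, ‖WithLp.toLp 2 (x - S a, a)‖)
    (le_antisymm
      ((ciInf_le ⟨0, by rintro _ ⟨a, rfl⟩; exact norm_nonneg _⟩ (0 : H)).trans
        (by simp))
      (Real.iInf_nonneg fun _ => norm_nonneg _))
    (fun x y => le_ciInf_add_ciInf fun a b => by
      refine (ciInf_le ⟨0, by rintro _ ⟨a, rfl⟩; exact norm_nonneg _⟩ (a + b)).trans ?_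
      refine le_trans (le_of_eq ?_) (norm_add_le _ _)
      rw [← WithLp.toLp_add, Prod.mk_add_mk, map_add]
      congr 3
      abel)
    (fun c x => by
      rw [Real.mul_iInf_of_nonneg (norm_nonneg c)]
      refine le_ciInf fun a => ?_
      refine (ciInf_le ⟨0, by rintro _ ⟨a, rfl⟩; exact norm_nonneg _⟩ (c • a)).trans ?_
      rw [← norm_smul, ← WithLp.toLp_smul, Prod.smul_mk, map_smul, smul_sub])

section
variable {X H : Type*} [NormedAddCommGroup X] [NormedSpace ℝ X]
    [NormedAddCommGroup H] [InnerProductSpace ℝ H] (S : H →L[ℝ] X)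

theorem smoothSeminorm_le (x : X) (a : H) :
    smoothSeminorm S x ≤ ‖WithLp.toLp 2 (x - S a, a)‖ :=
  ciInf_le (f := fun a : H => ‖WithLp.toLp 2 (x - S a, a)‖)
    ⟨0, by rintro _ ⟨a, rfl⟩; exact norm_nonneg _⟩ a

theorem exists_lt_smoothSeminorm (x : X) {r : ℝ} (h : smoothSeminorm S x < r) :
    ∃ a : H, ‖WithLp.toLp 2 (x - S a, a)‖ < r :=
  exists_lt_of_ciInf_lt (f := fun a : H => ‖WithLp.toLp 2 (x - S a, a)‖) h

theorem smoothSeminorm_le_norm (x : X) : smoothSeminorm S x ≤ ‖x‖ :=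
  (smoothSeminorm_le S x 0).trans (by simp)

theorem norm_le_smoothSeminorm (x : X) : ‖x‖ ≤ (1 + ‖S‖) * smoothSeminorm S x := by
  by_contra! hlt
  have hS : 0 < 1 + ‖S‖ := by positivity
  obtain ⟨a, ha⟩ := exists_lt_smoothSeminorm S x
    (show smoothSeminorm S x < ‖x‖ / (1 + ‖S‖) by rwa [lt_div_iff₀ hS, mul_comm])
  have h1 : ‖x - S a‖ ≤ ‖WithLp.toLp 2 (x - S a, a)‖ :=
    WithLp.norm_fst_le X (WithLp.toLp 2 (x - S a, a))
  have h2 : ‖a‖ ≤ ‖WithLp.toLp 2 (x - S a, a)‖ :=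
    WithLp.norm_snd_le X (WithLp.toLp 2 (x - S a, a))
  rw [lt_div_iff₀ hS] at ha
  have h3 : ‖x‖ ≤ ‖x - S a‖ + ‖S a‖ := by simpa using norm_add_le (x - S a) (S a)
  nlinarith [S.le_opNorm a, norm_nonneg S]

/-- Replacing `a` by `a ± b` in a nearly optimal decomposition of `x` leaves the component in `X`
unchanged, so only the parallelogram law in `H` is needed. -/
theorem smoothSeminorm_sq_add_sq_le (x : X) (b : H) :
    smoothSeminorm S (x + S b) ^ 2 + smoothSeminorm S (x - S b) ^ 2 ≤
      2 * smoothSeminorm S x ^ 2 + 2 * ‖b‖ ^ 2 := by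
  refine le_of_forall_pos_le_add fun ε hε => ?_
  have hq := apply_nonneg (smoothSeminorm S) x
  obtain ⟨a, ha⟩ := exists_lt_smoothSeminorm S x
    (show smoothSeminorm S x < √(smoothSeminorm S x ^ 2 + ε / 2) from
      Real.lt_sqrt_of_sq_lt (by linarith))
  have h0 := Real.lt_sqrt (norm_nonneg (WithLp.toLp 2 (x - S a, a))) |>.1 ha
  have h1 := pow_le_pow_left₀ (apply_nonneg _ _) (smoothSeminorm_le S (x + S b) (a + b)) 2
  have h2 := pow_le_pow_left₀ (apply_nonneg _ _) (smoothSeminorm_le S (x - S b) (a - b)) 2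
  have e1 : x + S b - S (a + b) = x - S a := by rw [map_add]; abel
  have e2 : x - S b - S (a - b) = x - S a := by rw [map_sub]; abel
  have h3 := parallelogram_law_with_norm ℝ a b
  rw [e1, WithLp.prod_norm_sq_eq_of_L2] at h1
  rw [e2, WithLp.prod_norm_sq_eq_of_L2] at h2
  rw [WithLp.prod_norm_sq_eq_of_L2] at h0
  change ‖x - S a‖ ^ 2 + ‖a‖ ^ 2 < _ at h0
  change _ ≤ ‖x - S a‖ ^ 2 + ‖a + b‖ ^ 2 at h1
  change _ ≤ ‖x - S a‖ ^ 2 + ‖a - b‖ ^ 2 at h2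
  nlinarith

/-- The second-difference form of Gateaux differentiability away from the origin. -/
def IsGateauxSmooth (q : Seminorm ℝ X) : Prop :=
  ∀ x h : X, x ≠ 0 →
    Tendsto (fun t : ℝ => (q (x + t • h) + q (x - t • h) - 2 * q x) / t) (𝓝[>] 0) (𝓝 0)

theorem Seminorm.two_mul_le_add (q : Seminorm ℝ X) (x h : X) :
    2 * q x ≤ q (x + h) + q (x - h) := by
  have := map_add_le_add q (x + h) (x - h)
  rwa [add_add_sub_cancel, ← two_smul ℝ, map_smul_eq_mul, Real.norm_ofNat] at this

/-- In directions from the range of `S` the second difference is `O(t²)`; density and the Lipschitz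
bound `q ≤ ‖·‖` carry `o(t)` over to all directions. -/
theorem isGateauxSmooth_smoothSeminorm (hS : DenseRange S) :
    IsGateauxSmooth (smoothSeminorm S) := by
  intro x h hx
  set q := smoothSeminorm S
  have hq : 0 < q x := by
    have := norm_le_smoothSeminorm S x
    have h1 : 0 < ‖x‖ := norm_pos_iff.2 hx
    by_contra! hle
    nlinarith [norm_nonneg S]
  rw [Metric.tendsto_nhds]
  intro ε hε
  obtain ⟨b, hb⟩ := hS.exists_dist_lt h (show 0 < ε / 4 by positivity)
  rw [dist_eq_norm] at hb
  have hδ : 0 < ε * q x / (2 * (‖b‖ ^ 2 + 1)) := by positivity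
  filter_upwards [Ioo_mem_nhdsGT hδ] with t ht
  obtain ⟨ht0, ht1⟩ := ht
  rw [lt_div_iff₀ (by positivity)] at ht1
  have key := smoothSeminorm_sq_add_sq_le S x (t • b)
  rw [norm_smul, mul_pow, Real.norm_eq_abs, sq_abs, map_smul] at key
  have k1 : q (x + t • S b) + q (x - t • S b) - 2 * q x ≤ t ^ 2 * ‖b‖ ^ 2 / q x := by
    -- From `(q(x ± t S b) - q x)² ≥ 0` one has `2 q(x) q(x ± t S b) ≤ q(x ± t S b)² + q(x)²`; sum
    -- the two and use `key`.
    rw [le_div_iff₀ hq]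
    nlinarith [sq_nonneg (q (x + t • S b) - q x), sq_nonneg (q (x - t • S b) - q x)]
  have k2 : q (t • (h - S b)) ≤ t * (ε / 4) := by
    rw [map_smul_eq_mul, Real.norm_of_nonneg ht0.le]
    exact mul_le_mul_of_nonneg_left ((smoothSeminorm_le_norm S _).trans hb.le) ht0.le
  have k3 : q (x + t • h) ≤ q (x + t • S b) + q (t • (h - S b)) := by
    refine le_trans (le_of_eq ?_) (map_add_le_add q _ _)
    congr 1; rw [smul_sub]; abel
  have k4 : q (x - t • h) ≤ q (x - t • S b) + q (t • (h - S b)) := by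
    refine le_trans (le_of_eq ?_) (map_sub_le_add q _ _)
    congr 1; rw [smul_sub]; abel
  have k5 := q.two_mul_le_add x (t • h)
  rw [Real.dist_eq, sub_zero, abs_of_nonneg (div_nonneg (by linarith) ht0.le), div_lt_iff₀ ht0]
  have k6 : t ^ 2 * ‖b‖ ^ 2 / q x < t * (ε / 2) := by
    rw [div_lt_iff₀ hq]
    nlinarith [mul_pos ht0 ht0]
  linarith

end

section
variable (X : Type*) [NormedAddCommGroup X] [NormedSpace ℝ X]

theorem exists_denseRange_lp_two [CompleteSpace X] [TopologicalSpace.SeparableSpace X] :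
    ∃ S : lp (fun _ : ℕ => ℝ) 2 →L[ℝ] X, DenseRange S := by
  set d := TopologicalSpace.denseSeq X
  set c : ℕ → ℝ := fun k => (1 / 2) ^ k * (1 + ‖d k‖)⁻¹ with hc
  have hcd : ∀ k, ‖c k • d k‖ ≤ (1 / 2) ^ k := fun k => by
    rw [norm_smul, Real.norm_of_nonneg (by positivity), hc]
    simp only
    rw [mul_assoc, inv_mul_eq_div]
    refine mul_le_of_le_one_right (by positivity) ?_
    rw [div_le_one (by positivity)]
    linarith
  have hb : ∀ (a : lp (fun _ : ℕ => ℝ) 2) k, ‖a k • c k • d k‖ ≤ ‖a‖ * (1 / 2) ^ k :=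
    fun a k => by
      rw [norm_smul]
      exact mul_le_mul (lp.norm_apply_le_norm two_ne_zero a k) (hcd k) (norm_nonneg _)
        (norm_nonneg _)
  have hsum : ∀ a : lp (fun _ : ℕ => ℝ) 2, Summable fun k => a k • c k • d k := fun a =>
    Summable.of_norm_bounded (summable_geometric_two.mul_left ‖a‖) (hb a)
  let L : lp (fun _ : ℕ => ℝ) 2 →ₗ[ℝ] X :=
    { toFun := fun a => ∑' k, a k • c k • d k
      map_add' := fun a b => by
        rw [← (hsum a).tsum_add (hsum b)]
        simp [add_smul]
      map_smul' := fun r a => by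
        rw [RingHom.id_apply, ← (hsum a).tsum_const_smul r]
        simp [mul_smul] }
  refine ⟨L.mkContinuous 2 fun a => ?_, ?_⟩
  · have := tsum_of_norm_bounded (summable_geometric_two.mul_left ‖a‖).hasSum (hb a)
    rwa [tsum_mul_left, tsum_geometric_two, mul_comm] at this
  · refine (TopologicalSpace.denseRange_denseSeq X).mono ?_
    rintro _ ⟨k, rfl⟩
    refine ⟨(c k)⁻¹ • lp.single 2 k (1 : ℝ), ?_⟩
    have hck : c k ≠ 0 := by positivity
    rw [map_smul, inv_smul_eq_iff₀ hck]
    change ∑' i, (lp.single 2 k (1 : ℝ) : ℕ → ℝ) i • c i • d i = _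
    rw [tsum_eq_single k fun i hi => by simp [lp.single_apply, hi]]
    simp [d]

theorem exists_isGateauxSmooth [CompleteSpace X] [TopologicalSpace.SeparableSpace X] :
    ∃ q : Seminorm ℝ X, IsGateauxSmooth q ∧ IsEquivalentNorm q := by
  obtain ⟨S, hS⟩ := exists_denseRange_lp_two X
  refine ⟨smoothSeminorm S, isGateauxSmooth_smoothSeminorm S hS, (1 + ‖S‖)⁻¹, 1, by positivity,
    one_pos, fun x => ⟨?_, ?_⟩⟩
  · rw [inv_mul_le_iff₀ (by positivity)]
    exact norm_le_smoothSeminorm S x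
  · rw [one_mul]
    exact smoothSeminorm_le_norm S x

end

/-! ### Sums `∑ |ψ i|` and their non-smooth points. -/

section
variable {X ι : Type*} [NormedAddCommGroup X] [NormedSpace ℝ X]
    (ψ : ι → StrongDual ℝ X)

theorem summable_abs_apply {ψ : ι → StrongDual ℝ X} (hψ : Summable fun i => ‖ψ i‖) (x : X) :
    Summable fun i => |ψ i x| :=
  Summable.of_nonneg_of_le (fun _ => abs_nonneg _) (fun i => (ψ i).le_opNorm x)
    (hψ.mul_right ‖x‖)

/-- The seminorm `x ↦ ∑ |ψ i x|`. -/
noncomputable def absSum (hψ : Summable fun i => ‖ψ i‖) : Seminorm ℝ X :=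
  Seminorm.of (fun x => ∑' i, |ψ i x|)
    (fun x y => by
      rw [← (summable_abs_apply hψ x).tsum_add (summable_abs_apply hψ y)]
      refine (summable_abs_apply hψ _).tsum_le_tsum (fun i => ?_)
        ((summable_abs_apply hψ x).add (summable_abs_apply hψ y))
      rw [map_add]
      exact abs_add_le _ _)
    (fun c x => by
      rw [← tsum_mul_left]
      simp [abs_mul])

variable {ψ}

theorem absSum_apply (hψ : Summable fun i => ‖ψ i‖) (x : X) :
    absSum ψ hψ x = ∑' i, |ψ i x| := rfl

theorem absSum_le (hψ : Summable fun i => ‖ψ i‖) (x : X) :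
    absSum ψ hψ x ≤ (∑' i, ‖ψ i‖) * ‖x‖ := by
  rw [absSum_apply, ← tsum_mul_right]
  exact (summable_abs_apply hψ x).tsum_le_tsum (fun i => (ψ i).le_opNorm x) (hψ.mul_right ‖x‖)

theorem tendsto_abs_second_difference (a b : ℝ) :
    Tendsto (fun t : ℝ => (|a + t * b| + |a - t * b| - 2 * |a|) / t) (𝓝[>] 0)
      (𝓝 (if a = 0 then 2 * |b| else 0)) := by
  split_ifs with ha
  · refine tendsto_const_nhds.congr' ?_
    filter_upwards [self_mem_nhdsWithin] with t ht
    have ht : 0 < t := ht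
    simp only [ha, zero_add, zero_sub, abs_neg, abs_mul, abs_of_pos ht, abs_zero]
    field_simp
    ring
  · refine tendsto_const_nhds.congr' ?_
    have hδ : 0 < |a| / (|b| + 1) := by positivity
    filter_upwards [Ioo_mem_nhdsGT hδ] with t ht
    obtain ⟨ht0, ht1⟩ := ht
    rw [lt_div_iff₀ (by positivity)] at ht1
    have h1 : |t * b| < |a| := by
      rw [abs_mul, abs_of_pos ht0]
      linarith
    rw [eq_comm, div_eq_zero_iff]
    left
    rcases lt_or_gt_of_ne ha with h | h
    · rw [abs_of_neg h] at h1 ⊢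
      rw [abs_lt] at h1
      rw [abs_of_neg (by linarith), abs_of_neg (by linarith)]
      ring
    · rw [abs_of_pos h] at h1 ⊢
      rw [abs_lt] at h1
      rw [abs_of_pos (by linarith), abs_of_pos (by linarith)]
      ring

theorem abs_second_difference_le (a b : ℝ) {t : ℝ} (ht : 0 < t) :
    ‖(|a + t * b| + |a - t * b| - 2 * |a|) / t‖ ≤ 2 * |b| := by
  have h1 := abs_add_le a (t * b)
  have h2 := abs_sub a (t * b)
  have h3 := abs_add_le (a + t * b) (a - t * b)
  rw [abs_mul, abs_of_pos ht] at h1 h2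
  have h4 : |a + t * b + (a - t * b)| = 2 * |a| := by
    rw [add_add_sub_cancel, ← two_mul, abs_mul, abs_two]
  rw [Real.norm_of_nonneg (div_nonneg (by linarith) ht.le), div_le_iff₀ ht]
  linarith

theorem tendsto_absSum_second_difference (hψ : Summable fun i => ‖ψ i‖) (x h : X) :
    Tendsto (fun t : ℝ => (absSum ψ hψ (x + t • h) + absSum ψ hψ (x - t • h)
      - 2 * absSum ψ hψ x) / t) (𝓝[>] 0)
      (𝓝 (∑' i, if ψ i x = 0 then 2 * |ψ i h| else 0)) := by
  have hs := summable_abs_apply hψ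
  refine (tendsto_tsum_of_dominated_convergence ((hs h).mul_left 2)
    (fun i => tendsto_abs_second_difference (ψ i x) (ψ i h)) ?_).congr fun t => ?_
  · filter_upwards [self_mem_nhdsWithin] with t ht i
    exact abs_second_difference_le _ _ ht
  · have e : ∀ i, |ψ i (x + t • h)| + |ψ i (x - t • h)| - 2 * |ψ i x| =
        |ψ i x + t * ψ i h| + |ψ i x - t * ψ i h| - 2 * |ψ i x| := fun i => by simp
    rw [tsum_div_const, absSum_apply, absSum_apply, absSum_apply, ← tsum_mul_left,
      ← (hs _).tsum_add (hs _), ← ((hs _).add (hs _)).tsum_sub ((hs _).mul_left 2),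
      tsum_congr e]

theorem tendsto_add_absSum_second_difference {q : Seminorm ℝ X} (hq : IsGateauxSmooth q)
    (hψ : Summable fun i => ‖ψ i‖) {x : X} (hx : x ≠ 0) (h : X) :
    Tendsto (fun t : ℝ => ((q + absSum ψ hψ) (x + t • h) + (q + absSum ψ hψ) (x - t • h)
      - 2 * (q + absSum ψ hψ) x) / t) (𝓝[>] 0)
      (𝓝 (∑' i, if ψ i x = 0 then 2 * |ψ i h| else 0)) := by
  have := (hq x h hx).add (tendsto_absSum_second_difference hψ x h)
  rw [zero_add] at this
  refine this.congr fun t => ?_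
  simp only [add_apply]
  ring

/-- A point of one hyperplane lying on no other member of a countable family of hyperplanes. -/
theorem exists_ne_zero_apply_eq_zero_forall_ne [CompleteSpace X] [Countable ι] {k : ι}
    (hprop : ∀ i, i ≠ k → ∃ x, ψ k x = 0 ∧ ψ i x ≠ 0) (hk : ∃ x ≠ 0, ψ k x = 0) :
    ∃ x ≠ 0, ψ k x = 0 ∧ ∀ i, i ≠ k → ψ i x ≠ 0 := by
  -- Baire category inside `ker (ψ k)`: proper closed subspaces have dense open complements. The
  -- index `none` (the zero subspace) keeps the point away from 0.
  have hdense : ∀ W : Submodule ℝ (ψ k).ker, W ≠ ⊤ → Dense ((W : Set (ψ k).ker)ᶜ) := by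
    intro W hW
    rw [← interior_eq_empty_iff_dense_compl]
    by_contra hne
    exact hW (W.eq_top_of_nonempty_interior' (Set.nonempty_iff_ne_empty.2 hne))
  let W : Option {i // i ≠ k} → Submodule ℝ (ψ k).ker := fun o =>
    o.elim ⊥ fun i => ((ψ i).comp (ψ k).ker.subtypeL).ker
  have hW : ∀ o, W o ≠ ⊤ := by
    rintro (_ | ⟨i, hi⟩) h
    · obtain ⟨x, hx, hx0⟩ := hk
      have : (⟨x, hx0⟩ : (ψ k).ker) ∈ W none := h ▸ Submodule.mem_top
      exact hx (congrArg Subtype.val ((Submodule.mem_bot ℝ).1 this))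
    · obtain ⟨x, hx, hx0⟩ := hprop i hi
      have : (⟨x, hx⟩ : (ψ k).ker) ∈ W (some ⟨i, hi⟩) := h ▸ Submodule.mem_top
      exact hx0 this
  have hcl : ∀ o, IsClosed (W o : Set (ψ k).ker) := by
    rintro (_ | ⟨i, hi⟩)
    · exact isClosed_singleton
    · exact ((ψ i).comp (ψ k).ker.subtypeL).isClosed_ker
  have : CompleteSpace (ψ k).ker := (ψ k).isClosed_ker.completeSpace_coe
  obtain ⟨x, hx⟩ := (dense_iInter_of_isOpen (fun o => (hcl o).isOpen_compl)
    fun o => hdense _ (hW o)).nonempty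
  rw [Set.mem_iInter] at hx
  exact ⟨x, fun h0 => hx none ((Submodule.mem_bot ℝ).2 (Subtype.ext h0)), x.2,
    fun i hi h0 => hx (some ⟨i, hi⟩) h0⟩

/-- The non-smooth points of `q + ∑ |ψ i|` determine the functionals `ψ i` up to sign. -/
theorem exists_apply_eq_or_neg_of_isometry [CompleteSpace X] [Countable ι] {q : Seminorm ℝ X}
    (hq : IsGateauxSmooth q) (hψ : Summable fun i => ‖ψ i‖)
    (hpos : ∀ x, (q + absSum ψ hψ) x = 0 → x = 0)
    (hne : ∀ i, ψ i ≠ 0) (hprop : ∀ i j (c : ℝ), ψ i = c • ψ j → i = j)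
    (T : X ≃ₗ[ℝ] X) (hT : ∀ x, (q + absSum ψ hψ) (T x) = (q + absSum ψ hψ) x) (k : ι) :
    ∃ i, (∀ x, ψ i (T x) = ψ k x) ∨ ∀ x, ψ i (T x) = -ψ k x := by
  obtain ⟨v, hv⟩ : ∃ v, ψ k v = 1 := by
    obtain ⟨y, hy⟩ := DFunLike.ne_iff.1 (hne k)
    exact ⟨(ψ k y)⁻¹ • y, by simpa using inv_mul_cancel₀ hy⟩
  have hker : ∀ x, ψ k (x - ψ k x • v) = 0 := fun x => by simp [hv]
  by_cases hk : ∃ x ≠ 0, ψ k x = 0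
  · have hfac : ∀ f : X →ₗ[ℝ] ℝ, (∀ x, ψ k x = 0 → f x = 0) → ∀ x, f x = ψ k x * f v := by
      intro f hf x
      have := hf _ (hker x)
      rw [map_sub, map_smul, smul_eq_mul, sub_eq_zero] at this
      exact this
    obtain ⟨x, hx, hxk, hxi⟩ := exists_ne_zero_apply_eq_zero_forall_ne (ψ := ψ) (k := k)
      (fun i hi => by
        by_contra! hcon
        refine hi (hprop i k (ψ i v) (ContinuousLinearMap.ext fun x => ?_))
        rw [smul_apply, smul_eq_mul, mul_comm]
        exact hfac (ψ i) hcon x) hk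
    -- The second differences of `p` at `T x` along `T h` and at `x` along `h` agree; at `x` only `ψ
    -- k` vanishes.
    have hD : ∀ h, ∑' i, (if ψ i (T x) = 0 then 2 * |ψ i (T h)| else 0) = 2 * |ψ k h| := by
      intro h
      have h1 := tendsto_add_absSum_second_difference hq hψ
        (show T x ≠ 0 by simpa using hx) (T h)
      have h2 := tendsto_add_absSum_second_difference hq hψ hx h
      simp only [← map_smul, ← map_add, ← map_sub, hT] at h1
      rw [tendsto_nhds_unique h1 h2, tsum_eq_single k fun i hi => if_neg (hxi i hi), if_pos hxk]
    have hsum : ∀ h, Summable fun i => if ψ i (T x) = 0 then 2 * |ψ i (T h)| else 0 := by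
      intro h
      refine Summable.of_nonneg_of_le (fun i => ?_) (fun i => ?_)
        ((summable_abs_apply hψ (T h)).mul_left 2) <;> split_ifs <;> first | positivity | rfl
    -- Each term of the sum in `hD` is at most `2 * |ψ k h|`, so `ψ i ∘ T` vanishes on `ker (ψ k)`.
    have hvan : ∀ i, ψ i (T x) = 0 → ∀ h, ψ i (T h) = ψ k h * ψ i (T v) := by
      intro i hi
      refine hfac ((ψ i : X →ₗ[ℝ] ℝ) ∘ₗ (T : X →ₗ[ℝ] X)) fun h hh => ?_
      have h1 := (hsum h).le_tsum i fun j _ => by split_ifs <;> positivity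
      rw [hD, hh, if_pos hi, abs_zero, mul_zero] at h1
      exact abs_nonpos_iff.1 (show |ψ i (T h)| ≤ 0 by linarith)
    obtain ⟨i, hi⟩ : ∃ i, ψ i (T x) = 0 := by
      by_contra! hcon
      have := hD v
      simp [hcon, hv] at this
    have huniq : ∀ j, ψ j (T x) = 0 → j = i := by
      intro j hj
      have hiv : ψ i (T v) ≠ 0 := fun h0 => hne i <| ContinuousLinearMap.ext fun y => by
        simpa [h0] using hvan i hi (T.symm y)
      refine hprop j i (ψ j (T v) / ψ i (T v)) (ContinuousLinearMap.ext fun y => ?_)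
      have h1 := hvan j hj (T.symm y)
      have h2 := hvan i hi (T.symm y)
      rw [T.apply_symm_apply] at h1 h2
      rw [smul_apply, smul_eq_mul, h1, h2]
      field_simp
    have habs := hD v
    rw [tsum_eq_single i fun j hj => if_neg fun h0 => hj (huniq j h0), if_pos hi, hv, abs_one]
      at habs
    refine ⟨i, ?_⟩
    rcases eq_or_eq_neg_of_abs_eq (show |ψ i (T v)| = 1 by linarith) with h1 | h1
    · left; intro y; rw [hvan i hi, h1, mul_one]
    · right; intro y; rw [hvan i hi, h1, mul_neg, mul_one]
  -- Here `ker (ψ k) = 0`, so `X` is a line and has no kink off the origin; an isometry of a line is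
  -- `±1`.
  · push Not at hk
    have hspan : ∀ x, x = ψ k x • v := fun x => by
      by_contra hne
      exact hk _ (sub_ne_zero.2 hne) (hker x)
    have hv0 : v ≠ 0 := by rintro rfl; simp at hv
    have h1 : |ψ k (T v)| = 1 := by
      have h := hT v
      rw [hspan (T v), map_smul_eq_mul, Real.norm_eq_abs] at h
      exact mul_right_cancel₀ (mt (hpos v) hv0) (h.trans (one_mul _).symm)
    have h2 : ∀ x, ψ k (T x) = ψ k x * ψ k (T v) := fun x => by
      conv_lhs => rw [hspan x, map_smul, map_smul, smul_eq_mul]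
    refine ⟨k, ?_⟩
    rcases eq_or_eq_neg_of_abs_eq h1 with h | h
    · left; intro x; rw [h2, h, mul_one]
    · right; intro x; rw [h2, h, mul_neg, mul_one]

end

/-! ### Biorthogonal frames and the action of `G`. -/

/-- A biorthogonal system indexed by `G`, together with a countable set `D` of functionals
vanishing on it which separates the remaining directions. -/
structure RegularFrame (G X : Type*) [DecidableEq G] [NormedAddCommGroup X]
    [NormedSpace ℝ X] where
  v : G → X
  e : G → StrongDual ℝ X
  D : Set (StrongDual ℝ X)
  e_v : ∀ g h, e g (v h) = if g = h then 1 else 0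
  countable_D : D.Countable
  zero_notMem : (0 : StrongDual ℝ X) ∉ D
  two_smul_mem : ∀ w ∈ D, (2 : ℝ) • w ∈ D
  apply_v : ∀ w ∈ D, ∀ g, w (v g) = 0
  eq_zero : ∀ x, (∀ g, e g x = 0) → (∀ w ∈ D, w x = 0) → x = 0

theorem exists_biorthogonal {ι X : Type*} [Finite ι] [DecidableEq ι] [NormedAddCommGroup X]
    [NormedSpace ℝ X] {v : ι → X} (hv : LinearIndependent ℝ v) :
    ∃ e : ι → StrongDual ℝ X, ∀ i j, e i (v j) = if i = j then 1 else 0 := by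
  have : FiniteDimensional ℝ (Submodule.span ℝ (Set.range v)) :=
    FiniteDimensional.span_of_finite ℝ (Set.finite_range v)
  choose e he _ using fun i => exists_extension_norm_eq (Submodule.span ℝ (Set.range v))
    (LinearMap.toContinuousLinearMap ((Module.Basis.span hv).coord i))
  refine ⟨e, fun i j => ?_⟩
  have hb : ((Module.Basis.span hv j : Submodule.span ℝ (Set.range v)) : X) = v j :=
    congrArg Subtype.val (Module.Basis.span_apply hv j)
  rw [← hb, he, LinearMap.coe_toContinuousLinearMap', Module.Basis.coord_apply,
    Module.Basis.repr_self, Finsupp.single_apply]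
  simp only [eq_comm]

/-- Norming functionals of a dense sequence separate points: if all vanish at `x`, then `‖d‖ ≤ ‖d -
x‖` for each `d` in the sequence, which fails near `x ≠ 0`. -/
theorem exists_separating_sequence (X : Type*) [NormedAddCommGroup X] [NormedSpace ℝ X]
    [TopologicalSpace.SeparableSpace X] :
    ∃ y : ℕ → StrongDual ℝ X, ∀ x, (∀ n, y n x = 0) → x = 0 := by
  choose y hy1 hy using fun n => exists_dual_vector'' ℝ (TopologicalSpace.denseSeq X n)
  refine ⟨y, fun x hx => ?_⟩
  by_contra hne
  have hpos : 0 < ‖x‖ / 2 := by positivity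
  obtain ⟨n, hn⟩ := (TopologicalSpace.denseRange_denseSeq X).exists_dist_lt x hpos
  set d := TopologicalSpace.denseSeq X n
  have h1 : ‖d‖ ≤ ‖d - x‖ := by
    have h2 : y n (d - x) = ‖d‖ := by rw [map_sub, hx, sub_zero]; exact hy n
    have h3 := (y n).le_of_opNorm_le (hy1 n) (d - x)
    rw [h2, norm_norm, one_mul] at h3
    exact h3
  rw [dist_eq_norm] at hn
  rw [norm_sub_rev] at h1
  have h4 := norm_sub_norm_le x d
  linarith

set_option linter.unusedSectionVars false

namespace RegularFrame

variable {G X : Type*} [Group G] [Fintype G] [DecidableEq G] [NormedAddCommGroup X]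
  [NormedSpace ℝ X]

theorem nonempty [TopologicalSpace.SeparableSpace X]
    (hdim : (Nat.card G : Cardinal) ≤ Module.rank ℝ X) : Nonempty (RegularFrame G X) := by
  obtain ⟨s, hs, hlin⟩ := le_rank_iff_exists_linearIndependent_finset.1 hdim
  have hcard : Fintype.card G = Fintype.card s := by
    rw [Fintype.card_coe, hs, Nat.card_eq_fintype_card]
  let φ : G ≃ s := Fintype.equivOfCardEq hcard
  let v : G → X := fun g => φ g
  obtain ⟨e, he⟩ := exists_biorthogonal (show LinearIndependent ℝ v from hlin.comp φ φ.injective)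
  obtain ⟨y, hy⟩ := exists_separating_sequence X
  -- `P` projects onto the common kernel of the `e h` along the span of the `v h`.
  let P : X →L[ℝ] X := ContinuousLinearMap.id ℝ X - ∑ h, (e h).smulRight (v h)
  have hP : ∀ x, P x = x - ∑ h, e h x • v h := fun x => by simp [P]
  have hPv : ∀ g, P (v g) = 0 := fun g => by simp [hP, he]
  refine ⟨⟨v, e, {w | w ≠ 0 ∧ ∃ n m : ℕ, w = (2 : ℝ) ^ m • (y n).comp P}, he, ?_, ?_, ?_, ?_, ?_⟩⟩
  · refine (Set.countable_range
      fun k : ℕ × ℕ => (2 : ℝ) ^ k.2 • (y k.1).comp P).mono ?_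
    rintro _ ⟨-, n, m, rfl⟩
    exact ⟨(n, m), rfl⟩
  · exact fun h => h.1 rfl
  · rintro w ⟨hw, n, m, rfl⟩
    refine ⟨smul_ne_zero two_ne_zero hw, n, m + 1, ?_⟩
    rw [smul_smul, pow_succ']
  · rintro w ⟨-, n, m, rfl⟩ g
    simp [hPv]
  · intro x hx hw
    have hPx : P x = x := by simp [hP, hx]
    refine hy x fun n => ?_
    by_cases h0 : (y n).comp P = 0
    · simpa [hPx] using congrArg (fun f : StrongDual ℝ X => f x) h0
    · simpa [hPx] using hw _ ⟨h0, n, 0, by simp⟩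

variable (F : RegularFrame G X)

/-- The action of `G` permuting the vectors `v` and fixing the common kernel of the `e`. -/
noncomputable def translate (g : G) : X →L[ℝ] X :=
  ContinuousLinearMap.id ℝ X + ∑ h, (F.e h).smulRight (F.v (g * h) - F.v h)

theorem translate_apply (g : G) (x : X) :
    F.translate g x = x + ∑ h, F.e h x • (F.v (g * h) - F.v h) := by
  simp [translate]

theorem e_translate (a g : G) (x : X) : F.e a (F.translate g x) = F.e (g⁻¹ * a) x := by
  rw [translate_apply, map_add, map_sum]
  simp only [map_smul, map_sub, F.e_v, smul_eq_mul, mul_sub, Finset.sum_sub_distrib]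
  simp [← inv_mul_eq_iff_eq_mul]

theorem apply_translate {w : StrongDual ℝ X} (hw : w ∈ F.D) (g : G) (x : X) :
    w (F.translate g x) = w x := by
  simp [translate_apply, F.apply_v w hw]

theorem ext_apply {x y : X} (he : ∀ g, F.e g x = F.e g y) (hw : ∀ w ∈ F.D, w x = w y) :
    x = y := by
  refine sub_eq_zero.1 (F.eq_zero _ (fun g => ?_) fun w h => ?_)
  · rw [map_sub, he, sub_self]
  · rw [map_sub, hw w h, sub_self]

theorem translate_mul (g h : G) (x : X) :
    F.translate (g * h) x = F.translate g (F.translate h x) := by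
  refine F.ext_apply (fun a => ?_) fun w hw => ?_
  · simp only [e_translate, mul_inv_rev, mul_assoc]
  · simp only [F.apply_translate hw]

theorem translate_one (x : X) : F.translate 1 x = x := by simp [translate_apply]

theorem translate_v (g h : G) : F.translate g (F.v h) = F.v (g * h) := by
  simp [translate_apply, F.e_v]

theorem v_injective : Function.Injective F.v := by
  intro g h hgh
  by_contra hne
  have h1 := F.e_v g h
  rw [← hgh, F.e_v, if_pos rfl, if_neg hne] at h1
  exact one_ne_zero h1

/-- The representation of `G` by linear automorphisms. -/
noncomputable def translateHom : G →* X ≃ₗ[ℝ] X where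
  toFun g := LinearEquiv.ofLinearMap (F.translate g : X →ₗ[ℝ] X) (F.translate g⁻¹ : X →ₗ[ℝ] X)
    (LinearMap.ext fun x => by
      change F.translate g (F.translate g⁻¹ x) = x
      rw [← translate_mul, mul_inv_cancel, translate_one])
    (LinearMap.ext fun x => by
      change F.translate g⁻¹ (F.translate g x) = x
      rw [← translate_mul, inv_mul_cancel, translate_one])
  map_one' := LinearEquiv.ext F.translate_one
  map_mul' g h := LinearEquiv.ext (F.translate_mul g h)

theorem translateHom_apply (g : G) (x : X) : F.translateHom g x = F.translate g x := rfl

/-! ### Rigidity of the test functionals. -/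

/-- The functionals `e g + 2 e (g h)` and `e g + 2 w`, which rigidify the frame. -/
noncomputable def test : G × (G ⊕ F.D) → StrongDual ℝ X
  | (g, .inl h) => F.e g + (2 : ℝ) • F.e (g * h)
  | (g, .inr w) => F.e g + (2 : ℝ) • w.1

theorem test_inl (g h : G) (x : X) :
    F.test (g, .inl h) x = F.e g x + 2 * F.e (g * h) x := rfl

theorem test_inr (g : G) (w : F.D) (x : X) :
    F.test (g, .inr w) x = F.e g x + 2 * w.1 x := rfl

theorem test_translate (g a : G) (j : G ⊕ F.D) (x : X) :
    F.test (g, j) (F.translate a x) = F.test (a⁻¹ * g, j) x := by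
  rcases j with h | w
  · simp only [test_inl, e_translate, mul_assoc]
  · simp only [test_inr, e_translate, F.apply_translate w.2]

theorem e_sum (g : G) : F.e g (∑ h, F.v h) = 1 := by simp [F.e_v]

theorem D_sum (w : F.D) : w.1 (∑ h, F.v h) = 0 := by simp [F.apply_v w.1 w.2]

theorem test_ne_zero (i : G × (G ⊕ F.D)) : F.test i ≠ 0 := by
  intro h0
  have h1 : F.test i (∑ h, F.v h) = 0 := by rw [h0]; rfl
  obtain ⟨g, h | w⟩ := i
  · rw [test_inl, e_sum, e_sum] at h1; norm_num at h1
  · rw [test_inr, e_sum, D_sum] at h1; norm_num at h1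

theorem exists_e_eq_zero (w : F.D) : ∃ x, (∀ g, F.e g x = 0) ∧ w.1 x ≠ 0 := by
  obtain ⟨x, hx⟩ := DFunLike.ne_iff.1 (show w.1 ≠ 0 from fun h => F.zero_notMem (h ▸ w.2))
  refine ⟨x - ∑ h, F.e h x • F.v h, fun g => ?_, ?_⟩
  · simp [F.e_v]
  · simpa [F.apply_v w.1 w.2] using hx

/-- At `∑ h, F.v h` the two kinds of test take the values 3 and 1, which fixes `c` within a kind.
Vectors killed by every `e g` but not by `w` tell the kinds apart. -/
theorem eq_of_test_eq_smul (i j : G × (G ⊕ F.D)) (c : ℝ) (h : F.test i = c • F.test j) :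
    i = j := by
  have h : ∀ x, F.test i x = c * F.test j x := fun x => by rw [h]; rfl
  have hs := h (∑ h, F.v h)
  obtain ⟨g, a | w⟩ := i <;> obtain ⟨g', a' | w'⟩ := j
  · simp only [test_inl, e_sum] at hs
    have hc : c = 1 := by linarith
    subst hc
    simp only [test_inl, one_mul] at h
    have hg : g = g' := by
      by_contra hne
      have := h (F.v g)
      simp only [F.e_v, if_neg (Ne.symm hne)] at this
      split_ifs at this <;> norm_num at this
    subst hg
    have := h (F.v (g * a))
    simp only [F.e_v, add_right_inj, if_true] at this
    split_ifs at this with h1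
    · rw [mul_left_cancel h1]
    · norm_num at this
  · obtain ⟨x, hx, hw⟩ := F.exists_e_eq_zero w'
    have h1 := h x
    simp only [test_inl, test_inr, e_sum, D_sum, hx] at hs h1
    have hc : c = 3 := by linarith
    subst hc
    exact absurd (by linarith) hw
  · obtain ⟨x, hx, hw⟩ := F.exists_e_eq_zero w
    have h1 := h x
    simp only [test_inl, test_inr, hx] at h1
    exact absurd (by linarith) hw
  · simp only [test_inr, e_sum, D_sum] at hs
    have hc : c = 1 := by linarith
    subst hc
    simp only [test_inr, one_mul] at h
    have hg : g = g' := by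
      by_contra hne
      have := h (F.v g)
      simp only [F.e_v, if_neg (Ne.symm hne), F.apply_v _ w.2, F.apply_v _ w'.2] at this
      norm_num at this
    subst hg
    have hw : w = w' := Subtype.ext <| ContinuousLinearMap.ext fun x => by
      have := h x
      linarith
    rw [hw]

/-- `R` permutes each `G`-orbit of test functionals up to signs. -/
def PreservesTests (R : X →ₗ[ℝ] X) : Prop :=
  ∀ g j, ∃ g' : G, ∃ ε : ℝ, (ε = 1 ∨ ε = -1) ∧ ∀ x, F.test (g, j) (R x) = ε * F.test (g', j) x

variable {F} {R : X →ₗ[ℝ] X}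

theorem PreservesTests.e_apply (hR : F.PreservesTests R) (g : G) :
    ∃ g' : G, ∃ ε : ℝ, (ε = 1 ∨ ε = -1) ∧ ∀ x, F.e g (R x) = ε * F.e g' x := by
  obtain ⟨g', ε, hε, h⟩ := hR g (.inl 1)
  refine ⟨g', ε, hε, fun x => ?_⟩
  have := h x
  simp only [test_inl, mul_one] at this
  linarith

theorem PreservesTests.eq_self (hR : F.PreservesTests R) (h1 : ∀ x, F.e 1 (R x) = F.e 1 x)
    (x : X) : R x = x := by
  refine F.ext_apply (fun h => ?_) fun w hw => ?_
  · obtain ⟨h', δ, hδ, hh'⟩ := hR.e_apply h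
    obtain ⟨g, ε, hε, hg⟩ := hR 1 (.inl h)
    simp only [test_inl, one_mul, h1, hh'] at hg
    have hs := hg (∑ a, F.v a)
    simp only [e_sum] at hs
    -- `hs` reads `1 + 2δ = 3ε`, so both signs are `+1`. Then at `v 1` the left side is 1 or 3,
    -- while `g ≠ 1` would give 0 or 2.
    obtain rfl : ε = 1 := by
      rcases hε with rfl | rfl <;> rcases hδ with rfl | rfl <;> first | rfl | norm_num at hs
    obtain rfl : g = 1 := by
      by_contra hne
      have := hg (F.v 1)
      obtain rfl : δ = 1 := by linarith
      simp only [F.e_v, if_neg hne] at this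
      split_ifs at this <;> norm_num at this
    have := hg x
    simp only [one_mul] at this
    rw [hh']
    linarith
  -- Testing both `w` and `2 • w` fixes the signs: with `s` the sum of the `v a`, `ε = -1` forces `w
  -- (R s) = -1`, hence `ε' = -3`. Likewise `g ≠ 1` forces `w (R (v 1)) = -1/2`, and the test with
  -- `2 • w` takes the impossible value `-1`.
  · obtain ⟨g, ε, hε, hg⟩ := hR 1 (.inr ⟨w, hw⟩)
    obtain ⟨g', ε', hε', hg'⟩ := hR 1 (.inr ⟨_, F.two_smul_mem w hw⟩)
    simp only [test_inr, h1, smul_apply, smul_eq_mul] at hg hg'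
    have hs := hg (∑ a, F.v a)
    have hs' := hg' (∑ a, F.v a)
    have hw0 : w (∑ a, F.v a) = 0 := F.D_sum ⟨w, hw⟩
    simp only [e_sum, hw0] at hs hs'
    have hε1 : ε = 1 := by
      rcases hε with rfl | rfl <;> rcases hε' with rfl | rfl <;> linarith
    have hε1' : ε' = 1 := by
      rcases hε with rfl | rfl <;> rcases hε' with rfl | rfl <;> linarith
    subst hε1 hε1'
    obtain rfl : g = 1 := by
      by_contra hne
      have t := hg (F.v 1)
      have t' := hg' (F.v 1)
      simp only [F.e_v, if_neg hne, F.apply_v _ hw, if_true] at t t'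
      split_ifs at t' <;> linarith
    have := hg x
    linarith

theorem PreservesTests.exists_eq_translate (hR : F.PreservesTests R) :
    ∃ g : G, (∀ x, R x = F.translate g x) ∨ ∀ x, R x = -F.translate g x := by
  obtain ⟨g, ε, hε, hg⟩ := hR.e_apply 1
  have hεε : ε * ε = 1 := by rcases hε with rfl | rfl <;> norm_num
  -- Correcting `R` by a sign and a translation makes it fix `e 1`, so `eq_self` applies.
  have hS : ∀ x, (ε • R ∘ₗ (F.translate g : X →ₗ[ℝ] X)) x = x := by
    refine PreservesTests.eq_self (F := F) (fun a j => ?_) fun x => ?_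
    · obtain ⟨a', δ, hδ, h⟩ := hR a j
      refine ⟨g⁻¹ * a', ε * δ, ?_, fun x => ?_⟩
      · rcases hε with rfl | rfl <;> rcases hδ with rfl | rfl <;> norm_num
      · change F.test (a, j) (ε • R (F.translate g x)) = _
        rw [map_smul, h, test_translate, smul_eq_mul, mul_assoc]
    · change F.e 1 (ε • R (F.translate g x)) = _
      rw [map_smul, hg, e_translate, inv_mul_cancel, smul_eq_mul, ← mul_assoc, hεε, one_mul]
  have hRx : ∀ x, R x = ε • F.translate g⁻¹ x := fun x => by
    have := hS (F.translate g⁻¹ x)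
    change ε • R (F.translate g (F.translate g⁻¹ x)) = _ at this
    rw [← translate_mul, mul_inv_cancel, translate_one] at this
    rw [← this, smul_smul, hεε, one_smul]
  refine ⟨g⁻¹, ?_⟩
  rcases hε with rfl | rfl
  · left; simpa using hRx
  · right; simpa using hRx

end RegularFrame

/-! ### Averaging over `G`, and weights separating the orbits. -/

namespace RegularFrame

variable {G X : Type*} [Group G] [Fintype G] [DecidableEq G] [NormedAddCommGroup X]
  [NormedSpace ℝ X] (F : RegularFrame G X)

/-- The sum of the translates of a seminorm under the action of `G`. -/
noncomputable def orbitSum (q : Seminorm ℝ X) : Seminorm ℝ X :=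
  Seminorm.of (fun x => ∑ g, q (F.translate g x))
    (fun x y => by
      rw [← Finset.sum_add_distrib]
      refine Finset.sum_le_sum fun g _ => ?_
      rw [map_add]
      exact map_add_le_add q _ _)
    (fun c x => by
      rw [Finset.mul_sum]
      simp only [map_smul, map_smul_eq_mul])

theorem orbitSum_apply (q : Seminorm ℝ X) (x : X) :
    F.orbitSum q x = ∑ g, q (F.translate g x) := rfl

theorem orbitSum_translate (q : Seminorm ℝ X) (a : G) (x : X) :
    F.orbitSum q (F.translate a x) = F.orbitSum q x := by
  simp only [orbitSum_apply, ← translate_mul]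
  exact Fintype.sum_equiv (Equiv.mulRight a) _ _ fun g => rfl

theorem translate_ne_zero (g : G) {x : X} (hx : x ≠ 0) : F.translate g x ≠ 0 := by
  rw [← translateHom_apply]
  exact (LinearEquiv.map_ne_zero_iff _).2 hx

theorem isGateauxSmooth_orbitSum {q : Seminorm ℝ X} (hq : IsGateauxSmooth q) :
    IsGateauxSmooth (F.orbitSum q) := by
  intro x h hx
  have := tendsto_finsetSum Finset.univ fun g _ =>
    hq (F.translate g x) (F.translate g h) (F.translate_ne_zero g hx)
  rw [Finset.sum_const_zero] at this
  refine this.congr fun t => ?_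
  rw [← Finset.sum_div, orbitSum_apply, orbitSum_apply, orbitSum_apply, Finset.sum_sub_distrib,
    Finset.sum_add_distrib, Finset.mul_sum]
  simp only [map_add, map_sub, map_smul]

theorem isEquivalentNorm_orbitSum {q : Seminorm ℝ X} (hq : IsEquivalentNorm q) :
    IsEquivalentNorm (F.orbitSum q) := by
  obtain ⟨A, B, hA, hB, hAB⟩ := hq
  refine ⟨A, B * (∑ g, ‖F.translate g‖ + 1), hA, by positivity, fun x => ⟨?_, ?_⟩⟩
  · refine (hAB x).1.trans ?_
    have := Finset.single_le_sum (f := fun g => q (F.translate g x))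
      (fun g _ => apply_nonneg q _) (Finset.mem_univ 1)
    rwa [translate_one] at this
  · have : F.orbitSum q x ≤ ∑ g, B * (‖F.translate g‖ * ‖x‖) :=
      Finset.sum_le_sum fun g _ => (hAB _).2.trans
        (mul_le_mul_of_nonneg_left ((F.translate g).le_opNorm x) hB.le)
    rw [← Finset.mul_sum, ← Finset.sum_mul] at this
    nlinarith [mul_nonneg hB.le (norm_nonneg x)]

/-- Tests in one orbit differ by composition with a translation, and there are finitely many
translations. -/
theorem exists_norm_test_le :
    ∃ M : ℝ, 0 < M ∧ ∀ g g' j, ‖F.test (g, j)‖ ≤ M * ‖F.test (g', j)‖ := by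
  refine ⟨∑ g, ‖F.translate g‖ + 1, by positivity, fun g g' j => ?_⟩
  have h : F.test (g, j) = (F.test (g', j)).comp (F.translate (g' * g⁻¹)) :=
    ContinuousLinearMap.ext fun x => by simp [test_translate]
  rw [h, mul_comm]
  refine (ContinuousLinearMap.opNorm_comp_le _ _).trans
    (mul_le_mul_of_nonneg_left ?_ (norm_nonneg _))
  have := Finset.single_le_sum (f := fun g => ‖F.translate g‖)
      (fun g _ => norm_nonneg _) (Finset.mem_univ (g' * g⁻¹))
  linarith

/-- The test functionals with weights, constant on orbits, decaying like powers of `r`. -/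
noncomputable def scaledTest (enc : G ⊕ F.D → ℕ) (r : ℝ) (i : G × (G ⊕ F.D)) : StrongDual ℝ X :=
  (r ^ (enc i.2 + 1) / ‖F.test (1, i.2)‖) • F.test i

variable (enc : G ⊕ F.D → ℕ) {r : ℝ}

theorem scaledTest_translate (g a : G) (j : G ⊕ F.D) (x : X) :
    F.scaledTest enc r (g, j) (F.translate a x) = F.scaledTest enc r (a⁻¹ * g, j) x := by
  simp [scaledTest, test_translate]

theorem weight_pos (hr : 0 < r) (j : G ⊕ F.D) : 0 < r ^ (enc j + 1) / ‖F.test (1, j)‖ :=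
  div_pos (pow_pos hr _) (norm_pos_iff.2 (F.test_ne_zero _))

theorem scaledTest_ne_zero (hr : 0 < r) (i : G × (G ⊕ F.D)) : F.scaledTest enc r i ≠ 0 :=
  smul_ne_zero (F.weight_pos enc hr i.2).ne' (F.test_ne_zero i)

theorem eq_of_scaledTest_eq_smul (hr : 0 < r) (i j : G × (G ⊕ F.D)) (c : ℝ)
    (h : F.scaledTest enc r i = c • F.scaledTest enc r j) : i = j := by
  refine F.eq_of_test_eq_smul i j ((r ^ (enc i.2 + 1) / ‖F.test (1, i.2)‖)⁻¹ *
    (c * (r ^ (enc j.2 + 1) / ‖F.test (1, j.2)‖))) ?_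
  rw [mul_smul, mul_smul]
  exact (eq_inv_smul_iff₀ (F.weight_pos enc hr i.2).ne').2 h

theorem norm_scaledTest (hr : 0 < r) (i : G × (G ⊕ F.D)) :
    ‖F.scaledTest enc r i‖ = r ^ (enc i.2 + 1) * (‖F.test i‖ / ‖F.test (1, i.2)‖) := by
  rw [scaledTest, norm_smul, Real.norm_of_nonneg (F.weight_pos enc hr i.2).le]
  ring

theorem norm_scaledTest_le {M : ℝ} (hM : ∀ g g' j, ‖F.test (g, j)‖ ≤ M * ‖F.test (g', j)‖)
    (hr : 0 < r) (i : G × (G ⊕ F.D)) : ‖F.scaledTest enc r i‖ ≤ r ^ (enc i.2 + 1) * M := by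
  rw [norm_scaledTest F enc hr]
  refine mul_le_mul_of_nonneg_left ?_ (by positivity)
  rw [div_le_iff₀ (norm_pos_iff.2 (F.test_ne_zero _))]
  exact hM i.1 1 i.2

theorem le_norm_scaledTest {M : ℝ} (hM : ∀ g g' j, ‖F.test (g, j)‖ ≤ M * ‖F.test (g', j)‖)
    (hr : 0 < r) (i : G × (G ⊕ F.D)) : r ^ (enc i.2 + 1) ≤ M * ‖F.scaledTest enc r i‖ := by
  rw [norm_scaledTest F enc hr, mul_left_comm, ← mul_div_assoc]
  refine le_mul_of_one_le_right (by positivity) ?_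
  rw [one_le_div (norm_pos_iff.2 (F.test_ne_zero _))]
  exact hM 1 i.1 i.2

theorem summable_geometric_comp {enc : G ⊕ F.D → ℕ} (henc : Function.Injective enc) {M : ℝ}
    (hM : 0 < M) : Summable fun i : G × (G ⊕ F.D) => (1 / 2 : ℝ) ^ (enc i.2 + 1) * M :=
  (summable_prod_of_nonneg fun i => by positivity).2
    ⟨fun _ => (summable_geometric_two.comp_injective
      ((add_left_injective 1).comp henc)).mul_right M, Summable.of_finite⟩

/-- If `i` lay in a later orbit than `i'`, its norm would be smaller by a factor `r` or more, up to
`M`; composing with `S` gains at most `K`, too little because `M * K * M * r < 1`. -/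
theorem enc_le_of_abs_comp_eq {M K : ℝ} (hM0 : 0 < M) (hK : 0 < K)
    (hM : ∀ g g' j, ‖F.test (g, j)‖ ≤ M * ‖F.test (g', j)‖)
    (hr : 0 < r) (hr1 : r ≤ 1) (hrM : M * K * M * r < 1) {S : X → X}
    (hS : ∀ x, ‖S x‖ ≤ K * ‖x‖) {i i' : G × (G ⊕ F.D)}
    (h : ∀ x, |F.scaledTest enc r i (S x)| = |F.scaledTest enc r i' x|) :
    enc i.2 ≤ enc i'.2 := by
  by_contra! hlt
  have h1 : ‖F.scaledTest enc r i'‖ ≤ K * ‖F.scaledTest enc r i‖ := by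
    refine ContinuousLinearMap.opNorm_le_bound _ (by positivity) fun x => ?_
    rw [Real.norm_eq_abs, ← h, ← Real.norm_eq_abs, mul_comm K, mul_assoc]
    exact ((F.scaledTest enc r i).le_opNorm _).trans
      (mul_le_mul_of_nonneg_left (hS x) (norm_nonneg _))
  have h2 := F.norm_scaledTest_le enc hM hr i
  have h3 := F.le_norm_scaledTest enc hM hr i'
  have h4 : r ^ (enc i.2 + 1) ≤ r ^ (enc i'.2 + 1) * r := by
    rw [← pow_succ]
    exact pow_le_pow_of_le_one hr.le hr1 (by omega)
  have h5 : r ^ (enc i'.2 + 1) ≤ r ^ (enc i'.2 + 1) * (M * K * M * r) :=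
    calc r ^ (enc i'.2 + 1) ≤ M * (K * ‖F.scaledTest enc r i‖) :=
          h3.trans (mul_le_mul_of_nonneg_left h1 hM0.le)
      _ ≤ M * (K * (r ^ (enc i'.2 + 1) * r * M)) := by
          gcongr
          exact h2.trans (mul_le_mul_of_nonneg_right h4 hM0.le)
      _ = _ := by ring
  have h6 : 0 < r ^ (enc i'.2 + 1) := pow_pos hr _
  nlinarith

theorem absSum_scaledTest_translate (hψ : Summable fun i => ‖F.scaledTest enc r i‖) (a : G)
    (x : X) : absSum _ hψ (F.translate a x) = absSum _ hψ x := by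
  rw [absSum_apply, absSum_apply, ← ((Equiv.mulLeft a⁻¹).prodCongr
    (Equiv.refl (G ⊕ F.D))).tsum_eq fun i => |F.scaledTest enc r i x|]
  exact tsum_congr fun i => by rw [← Prod.mk.eta (p := i), scaledTest_translate]; rfl

/-- The representation of `{-1, 1} × G` on `X`. -/
noncomputable def signedHom : ℤˣ × G →* X ≃ₗ[ℝ] X :=
  (DistribMulAction.toModuleAut ℝ X).noncommCoprod F.translateHom fun ε g =>
    LinearEquiv.ext fun x => (map_zsmul_unit (F.translateHom g) ε x).symm

theorem signedHom_apply (ε : ℤˣ) (g : G) (x : X) :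
    F.signedHom (ε, g) x = ε • F.translate g x := rfl

theorem signedHom_injective : Function.Injective F.signedHom := by
  rw [injective_iff_map_eq_one]
  rintro ⟨ε, g⟩ h
  have h1 : ε • F.v (g * 1) = F.v 1 := by
    rw [← translate_v, ← signedHom_apply, h]
    rfl
  have h2 := congrArg (F.e 1) h1
  rcases Int.units_eq_one_or ε with rfl | rfl
  · rw [one_smul] at h1
    have h3 := F.v_injective h1
    rw [mul_one] at h3
    rw [h3]
    rfl
  · rw [Units.neg_smul, one_smul, map_neg] at h2
    simp only [F.e_v, if_true] at h2
    split_ifs at h2 <;> norm_num at h2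

end RegularFrame

/-! ### Assembly of the norm. -/

theorem nonempty_mulEquiv_isomGroup {H X : Type*} [Group H] [NormedAddCommGroup X]
    [NormedSpace ℝ X] {p : Seminorm ℝ X} (φ : H →* X ≃ₗ[ℝ] X) (hinj : Function.Injective φ)
    (hmem : ∀ h x, p (φ h x) = p x)
    (hsurj : ∀ T : X ≃ₗ[ℝ] X, (∀ x, p (T x) = p x) → ∃ h, φ h = T) :
    Nonempty (H ≃* isomGroup p) :=
  ⟨MulEquiv.ofBijective (φ.codRestrict (isomGroup p) hmem)
    ⟨fun _ _ h => hinj (congrArg Subtype.val h), fun T =>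
      (hsurj T.1 T.2).imp fun _ h => Subtype.ext h⟩⟩

theorem mainTheorem10 (G : Type*) [Group G] [Finite G]
    (X : Type*) [NormedAddCommGroup X] [NormedSpace ℝ X] [CompleteSpace X]
    [TopologicalSpace.SeparableSpace X]
    (hdim : (Nat.card G : Cardinal) ≤ Module.rank ℝ X) :
    IsDisplayable (ℤˣ × G) X := by
  classical
  have := Fintype.ofFinite G
  obtain ⟨F⟩ := RegularFrame.nonempty hdim
  obtain ⟨q₀, hq₀, hq₀'⟩ := exists_isGateauxSmooth X
  set q := F.orbitSum q₀ with hq_def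
  have hq : IsGateauxSmooth q := F.isGateauxSmooth_orbitSum hq₀
  obtain ⟨A, B, hA, hB, hAB⟩ : IsEquivalentNorm q := F.isEquivalentNorm_orbitSum hq₀'
  obtain ⟨M, hM0, hM⟩ := F.exists_norm_test_le
  have : Countable F.D := F.countable_D.to_subtype
  obtain ⟨enc, henc⟩ := exists_injective_nat (G ⊕ F.D)
  have hC := F.summable_geometric_comp henc hM0
  -- `C` uses the ratio `1 / 2`, so the distortion bound `K` is independent of `r`, which can then
  -- be chosen small in terms of `K`; `r ≤ 1 / 2` keeps `C` a valid bound.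
  set C := ∑' i : G × (G ⊕ F.D), (1 / 2 : ℝ) ^ (enc i.2 + 1) * M with hC_def
  have hC0 : 0 ≤ C := tsum_nonneg fun i => by positivity
  set K := (B + C) / A with hK_def
  have hK : 0 < K := by positivity
  set r := 1 / (2 + M * K * M) with hr_def
  have hr : 0 < r := by positivity
  have hr2 : r ≤ 1 / 2 :=
    one_div_le_one_div_of_le two_pos (le_add_of_nonneg_right (by positivity))
  have hrM : M * K * M * r < 1 := by
    rw [hr_def, mul_one_div, div_lt_one (by positivity)]
    linarith
  have hle : ∀ i, ‖F.scaledTest enc r i‖ ≤ (1 / 2) ^ (enc i.2 + 1) * M := fun i =>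
    (F.norm_scaledTest_le enc hM hr i).trans
      (mul_le_mul_of_nonneg_right (pow_le_pow_left₀ hr.le hr2 _) hM0.le)
  have hψ : Summable fun i => ‖F.scaledTest enc r i‖ :=
    Summable.of_nonneg_of_le (fun _ => norm_nonneg _) hle hC
  set p := q + absSum _ hψ with hp_def
  have hlow : ∀ x, A * ‖x‖ ≤ p x := fun x =>
    (hAB x).1.trans (le_add_of_nonneg_right (apply_nonneg (absSum _ hψ) x))
  have hupp : ∀ x, p x ≤ (B + C) * ‖x‖ := fun x => by
    rw [add_mul]
    exact add_le_add (hAB x).2 ((absSum_le hψ x).trans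
      (mul_le_mul_of_nonneg_right (hψ.tsum_le_tsum hle hC) (norm_nonneg x)))
  have hbound : ∀ T : X ≃ₗ[ℝ] X, (∀ x, p (T x) = p x) → ∀ x, ‖T x‖ ≤ K * ‖x‖ := by
    intro T hT x
    rw [hK_def, div_mul_eq_mul_div, le_div_iff₀ hA, mul_comm]
    exact (hlow _).trans ((hT x).trans_le (hupp x))
  have hpos : ∀ x, p x = 0 → x = 0 := fun x hx => by
    have := hlow x
    rw [hx] at this
    exact norm_le_zero_iff.1 (nonpos_of_mul_nonpos_right this hA)
  refine ⟨p, ⟨A, B + C, hA, by positivity, fun x => ⟨hlow x, hupp x⟩⟩,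
    nonempty_mulEquiv_isomGroup F.signedHom F.signedHom_injective ?_ ?_⟩
  · rintro ⟨ε, g⟩ x
    have hinv : p (F.translate g x) = p x :=
      congrArg₂ (· + ·) (F.orbitSum_translate q₀ g x) (F.absSum_scaledTest_translate enc hψ g x)
    rw [F.signedHom_apply]
    rcases Int.units_eq_one_or ε with rfl | rfl
    · rw [one_smul, hinv]
    · rw [Units.neg_smul, one_smul, map_neg_eq_map, hinv]
  · intro T hT
    have hTs : ∀ x, p (T.symm x) = p x := fun x => by rw [← hT, T.apply_symm_apply]
    have htests : F.PreservesTests (T : X →ₗ[ℝ] X) := by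
      intro g j
      -- Applied to `T⁻¹`, since `ψ i ∘ T⁻¹ = ±ψ k` rewrites as `ψ k ∘ T = ±ψ i`, the form required
      -- by `PreservesTests`.
      obtain ⟨i, hi⟩ := exists_apply_eq_or_neg_of_isometry hq hψ hpos
        (F.scaledTest_ne_zero enc hr) (F.eq_of_scaledTest_eq_smul enc hr) T.symm hTs (g, j)
      have habs : ∀ x, |F.scaledTest enc r i (T.symm x)| = |F.scaledTest enc r (g, j) x| :=
        fun x => by rcases hi with hi | hi <;> simp [hi]
      have h1 : enc i.2 ≤ enc j :=
        F.enc_le_of_abs_comp_eq enc hM0 hK hM hr (by linarith) hrM (hbound _ hTs) habs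
      have h2 : enc j ≤ enc i.2 :=
        F.enc_le_of_abs_comp_eq enc (i := (g, j)) hM0 hK hM hr (by linarith) hrM (hbound _ hT)
          fun x => by rw [← habs, T.symm_apply_apply]
      obtain ⟨g', j'⟩ := i
      obtain rfl : j' = j := henc (le_antisymm h1 h2)
      have hw := (F.weight_pos enc hr j').ne'
      refine ⟨g', ?_⟩
      rcases hi with hi | hi
      · refine ⟨1, Or.inl rfl, fun x => mul_left_cancel₀ hw ?_⟩
        have := hi (T x)
        rw [T.symm_apply_apply] at this
        rw [one_mul]
        exact this.symm
      · refine ⟨-1, Or.inr rfl, fun x => mul_left_cancel₀ hw ?_⟩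
        have := hi (T x)
        rw [T.symm_apply_apply] at this
        rw [neg_one_mul, mul_neg]
        exact (neg_eq_iff_eq_neg.2 this).symm
    obtain ⟨g, hg | hg⟩ := htests.exists_eq_translate
    · exact ⟨(1, g), LinearEquiv.ext fun x => by
        rw [F.signedHom_apply, one_smul]; exact (hg x).symm⟩
    · exact ⟨(-1, g), LinearEquiv.ext fun x => by
        rw [F.signedHom_apply, Units.neg_smul, one_smul]; exact (hg x).symm⟩
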